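/- Let $0<\gamma\le 1$ and $\lambda>0$, and let $X$ be a non-negative random variable with the positive stable law $\mathrm{PS}(\gamma,\lambda)$, i.e. with Laplace transform $L_X(s)=E(e^{-sX})=e^{-\lambda s^\gamma}$ for $s\ge 0$. Let $a_*=L_X^{-1}(e^{-1})$, i.e. $a_*$ is the unique positive solution of $L_X(a_*)=e^{-1}$. Let $X_1,X_2,\ldots$ be independent copies of $X$. For $n\ge 1$ let $A=A_n$ be the positive solution of $$\frac1n\sum_{i=1}^n e^{-AX_i}=e^{-1},$$ which almost surely exists and is unique for every $n\ge1$, let $\widehat m_{1,A}=\frac1n\sum_{i=1}^n X_ie^{-AX_i}$, and put $$\widehat\gamma=e\,\widehat m_{1,A}\,A,\qquad \widehat\lambda=A^{-\widehat\gamma}.$$ Then: 1. $(\widehat\gamma,\widehat\lambda)$ converges almost surely to $(\gamma,\lambda)$ as $n\to\infty$. 2. $\sqrt n\,(\widehat\gamma-\gamma,\widehat\lambda-\lambda)$ converges in distribution, as $n\to\infty$, to the (possibly degenerate) bivariate normal law $\mathrm N_2(0,\Sigma)$, where $\Sigma$ is the variance-covariance matrix of the square-integrable random vector $$(S_1,S_2)=\bigl(a_*Xe^{1-a_*X},\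 -\lambda e^{1-a_*X}\{a_*X\log(a_*)+1\}\bigr).$$ 3. The sample variance-covariance matrix (with denominator $n-1$) of the random vectors $$(\Gamma_i,\Lambda_i)=\bigl(AX_ie^{1-AX_i},\ -\widehat\lambda e^{1-AX_i}\{AX_i\log(A)+1\}\bigr),\qquad i=1,\ldots,n,$$ is a strongly consistent estimator of $\Sigma$: it converges almost surely to $\Sigma$ as $n\to\infty$. -/

import Mathlib

open MeasureTheory ProbabilityTheory Filter Topology

noncomputable section

namespace PositiveStable

/-- The Laplace transform `L_X(s) = E(e^{-sX})` of a random variable `X` under `P`. -/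
def laplace {Ω : Type*} [MeasurableSpace Ω] (X : Ω → ℝ) (P : Measure Ω) (s : ℝ) : ℝ :=
  ∫ ω, Real.exp (-(s * X ω)) ∂P

/-- `X` is a non-negative random variable with the positive stable law `PS(γ, lam)`, i.e. with
Laplace transform `L_X(s) = e^{-lam s^γ}`, `s ≥ 0`. -/
structure HasPSLaw {Ω : Type*} [MeasurableSpace Ω] (X : Ω → ℝ) (γ lam : ℝ) (P : Measure Ω) :
    Prop where
  aemeasurable : AEMeasurable X P
  nonneg : ∀ᵐ ω ∂P, 0 ≤ X ω
  laplace_eq : ∀ s : ℝ, 0 ≤ s → laplace X P s = Real.exp (-(lam * s ^ γ))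

/-- The value `L⁻¹(e⁻¹)` of the inverse of `L` on `]0, ∞[`: a number `a > 0` with `L a = e⁻¹`. -/
def invAt (L : ℝ → ℝ) : ℝ :=
  Function.invFunOn L (Set.Ioi 0) (Real.exp (-1))

/-- The empirical Laplace transform `L_n(s) = (1/n) ∑ e^{-s x_i}` of the first `n` terms
of `x`. -/
def empLaplace (x : ℕ → ℝ) (n : ℕ) (s : ℝ) : ℝ :=
  (1 / (n : ℝ)) * ∑ i ∈ Finset.range n, Real.exp (-(s * x i))

/-- The data-driven censoring rate `A`, the solution of `L_n(A) = e⁻¹`. -/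
def rateEst (x : ℕ → ℝ) (n : ℕ) : ℝ :=
  invAt (empLaplace x n)

/-- The empirical censored moment `(1/n) ∑ x_i^r e^{-a x_i}`. -/
def empMoment (x : ℕ → ℝ) (n r : ℕ) (a : ℝ) : ℝ :=
  (1 / (n : ℝ)) * ∑ i ∈ Finset.range n, x i ^ r * Real.exp (-(a * x i))

/-- The estimator `e m̂_{1,A} A` of `γ`. -/
def gammaEst (x : ℕ → ℝ) (n : ℕ) : ℝ :=
  Real.exp 1 * empMoment x n 1 (rateEst x n) * rateEst x n

/-- The estimator `A^{-γ̂}` of `lam`. -/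
def lambdaEst (x : ℕ → ℝ) (n : ℕ) : ℝ :=
  rateEst x n ^ (-gammaEst x n)

/-- The vector `(a x e^{1 - a x}, -lam e^{1 - a x} (a x log a + 1))`. -/
def score (a lam x : ℝ) : Fin 2 → ℝ :=
  ![a * x * Real.exp (1 - a * x),
    -lam * Real.exp (1 - a * x) * (a * x * Real.log a + 1)]

/-- The variance-covariance matrix of a random vector `S`. -/
def covMat {Ω : Type*} [MeasurableSpace Ω] (S : Ω → Fin 2 → ℝ) (P : Measure Ω) :
    Matrix (Fin 2) (Fin 2) ℝ :=
  Matrix.of fun j k ↦ covariance (fun ω ↦ S ω j) (fun ω ↦ S ω k) P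

/-- The sample mean of the first `n` terms of `z`. -/
def sampleMean (z : ℕ → ℝ) (n : ℕ) : ℝ :=
  (1 / (n : ℝ)) * ∑ i ∈ Finset.range n, z i

/-- The sample variance-covariance matrix (with denominator `n - 1`) of the first `n` terms of a
sequence of vectors. -/
def sampleCov (z : ℕ → Fin 2 → ℝ) (n : ℕ) : Matrix (Fin 2) (Fin 2) ℝ :=
  Matrix.of fun j k ↦ (1 / ((n : ℝ) - 1)) * ∑ i ∈ Finset.range n,
    (z i j - sampleMean (fun l ↦ z l j) n) * (z i k - sampleMean (fun l ↦ z l k) n)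

/-- The plug-in estimator of the asymptotic covariance matrix: the sample variance-covariance
matrix of the vectors `(Γ_i, Λ_i)`, which are the vectors `score` at `x_i` with `A` and the
estimator of `lam` in place of the true parameters. -/
def covEst (x : ℕ → ℝ) (n : ℕ) : Matrix (Fin 2) (Fin 2) ℝ :=
  sampleCov (fun i ↦ score (rateEst x n) (lambdaEst x n) (x i)) n

end PositiveStable

end

open PositiveStable

/-!
The law `PS(γ, lam)` has the Laplace transform `L s = exp (-(lam * s ^ γ))`, so `L a = exp (-1)`
means `lam * a ^ γ = 1`, that is `lam = a ^ (-γ)`. Differentiating `L` under the expectation gives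
`s * E[X * exp (-s * X)] = γ * u * exp (-u)` with `u = lam * s ^ γ`; at `s = a`, where `u = 1`, this
equals `γ * exp (-1)`, which identifies `γ` as `exp 1 * a * E[X * exp (-a * X)]`
(`HasPSLaw.mul_censoredMoment_one`).

*Consistency.* The empirical transform is almost surely continuous and strictly decreasing from `1`
to `0`, because `X > 0` almost surely. By the law of large numbers at all positive rationals, the
solution `A` converges to `a` (`tendsto_rateEst`). The powers `x ^ r` are censored by
`exp (-(s * x))`, so the empirical moments are Lipschitz in `s` near `a`, uniformly in the sample,
and may be evaluated at `A` in place of `a`. The plug-in covariance is a polynomial in such moments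
at `A` and at `2 * A`, with coefficients continuous in `A` and in the estimator of `lam`
(`tendsto_covEst`).

*Asymptotic normality.* The function `u * exp (-u)` is critical at `u = 1`, so
`s * E[X * exp (-s * X)]` is critical at `s = a` (`HasPSLaw.mul_censoredMoment_two`), and replacing
`a` by `A` in the estimator of `γ` has no effect to first order (`gammaEst_sub_isLittleO`). The error
`A - a` itself is asymptotically linear in the fluctuation of the empirical transform at `a`
(`rateEst_sub_isEquivalent`). Together with the differentiability of `(s, g) ↦ s ^ (-g)`, the error
of the pair of estimators is almost surely equivalent, as a sequence of vectors, to the centred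
sample mean of the vectors `score a lam X_i` (`estimators_isEquivalent`). This mean obeys the
multivariate central limit theorem (`tendstoInDistribution_multivariate`), and almost surely
equivalent sequences have the same limit in distribution
(`tendstoInDistribution_of_isEquivalent`).
-/

namespace PositiveStable

/-! ### Censored powers and empirical moments -/

lemma pow_mul_exp_le {c x : ℝ} (hc : 0 < c) (hx : 0 ≤ x) (r : ℕ) :
    x ^ r * Real.exp (-(c * x)) ≤ r.factorial / c ^ r := by
  have h := Real.pow_div_factorial_le_exp (c * x) (by positivity) r
  rw [Real.exp_neg, ← div_eq_mul_inv, div_le_div_iff₀ (by positivity) (by positivity)]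
  rw [div_le_iff₀ (by positivity), mul_pow] at h
  linarith

lemma abs_exp_sub_one_sub_le (t : ℝ) : |Real.exp t - 1 - t| ≤ t ^ 2 * Real.exp |t| := by
  have h := Complex.norm_exp_sub_sum_le_norm_mul_exp (t : ℂ) 2
  simp only [Finset.sum_range_succ, Finset.sum_range_zero] at h
  have e : Complex.exp t - (0 + (t : ℂ) ^ 0 / (Nat.factorial 0 : ℕ) + (t : ℂ) ^ 1 /
      (Nat.factorial 1 : ℕ)) = ((Real.exp t - 1 - t : ℝ) : ℂ) := by
    push_cast; simp; ring
  rw [e, Complex.norm_real, Complex.norm_real, Real.norm_eq_abs, Real.norm_eq_abs, sq_abs] at h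
  exact h

/-- First-order Taylor expansion of `s ↦ x ^ r * exp (-(s * x))` at `a`, with a quadratic error
that is uniform in `x ≥ 0`: censoring keeps all the moments bounded. -/
lemma abs_censored_expansion_le {a b x : ℝ} (ha : 0 < a) (hb : |b - a| ≤ a / 2) (hx : 0 ≤ x)
    (r : ℕ) :
    |x ^ r * Real.exp (-(b * x)) - x ^ r * Real.exp (-(a * x))
        + (b - a) * (x ^ (r + 1) * Real.exp (-(a * x)))| ≤
      (r + 2).factorial / (a / 2) ^ (r + 2) * (b - a) ^ 2 := by
  have key : x ^ r * Real.exp (-(b * x)) - x ^ r * Real.exp (-(a * x))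
        + (b - a) * (x ^ (r + 1) * Real.exp (-(a * x))) =
      x ^ r * Real.exp (-(a * x)) *
        (Real.exp (-((b - a) * x)) - 1 - (-((b - a) * x))) := by
    have : Real.exp (-(b * x)) = Real.exp (-(a * x)) * Real.exp (-((b - a) * x)) := by
      rw [← Real.exp_add]; ring_nf
    rw [this]; ring
  rw [key, abs_mul, abs_of_nonneg (by positivity : 0 ≤ x ^ r * Real.exp (-(a * x)))]
  calc x ^ r * Real.exp (-(a * x)) * |Real.exp (-((b - a) * x)) - 1 - (-((b - a) * x))|
      ≤ x ^ r * Real.exp (-(a * x)) * ((-((b - a) * x)) ^ 2 * Real.exp |(-((b - a) * x))|) := by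
        gcongr; exact abs_exp_sub_one_sub_le _
    _ ≤ x ^ r * Real.exp (-(a * x)) * ((-((b - a) * x)) ^ 2 * Real.exp (a / 2 * x)) := by
        gcongr
        rw [abs_neg, abs_mul, abs_of_nonneg hx]
        gcongr
    _ = x ^ (r + 2) * Real.exp (-(a / 2 * x)) * (b - a) ^ 2 := by
        have : Real.exp (-(a / 2 * x)) = Real.exp (-(a * x)) * Real.exp (a / 2 * x) := by
          rw [← Real.exp_add]; ring_nf
        rw [this]; ring
    _ ≤ _ := by gcongr; exact pow_mul_exp_le (by positivity) hx _

lemma empMoment_zero (x : ℕ → ℝ) (n : ℕ) (s : ℝ) : empMoment x n 0 s = empLaplace x n s := by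
  simp [empMoment, empLaplace]

lemma abs_mean_le {z : ℕ → ℝ} {C : ℝ} (hC : 0 ≤ C) (hz : ∀ i, |z i| ≤ C) (n : ℕ) :
    |(1 / (n : ℝ)) * ∑ i ∈ Finset.range n, z i| ≤ C := by
  rcases Nat.eq_zero_or_pos n with rfl | hn
  · simpa using hC
  have hn' : (0 : ℝ) < n := by exact_mod_cast hn
  rw [abs_mul, abs_of_nonneg (by positivity : (0 : ℝ) ≤ 1 / n)]
  calc 1 / (n : ℝ) * |∑ i ∈ Finset.range n, z i| ≤ 1 / (n : ℝ) * ∑ i ∈ Finset.range n, C := by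
        gcongr
        exact (Finset.abs_sum_le_sum_abs _ _).trans (Finset.sum_le_sum fun i _ ↦ hz i)
    _ = C := by simp; field_simp

lemma abs_empMoment_expansion_le {x : ℕ → ℝ} (hx : ∀ i, 0 ≤ x i) {a b : ℝ} (ha : 0 < a)
    (hb : |b - a| ≤ a / 2) (n r : ℕ) :
    |empMoment x n r b - empMoment x n r a + (b - a) * empMoment x n (r + 1) a| ≤
      (r + 2).factorial / (a / 2) ^ (r + 2) * (b - a) ^ 2 := by
  have h := abs_mean_le (z := fun i ↦ x i ^ r * Real.exp (-(b * x i)) -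
    x i ^ r * Real.exp (-(a * x i)) + (b - a) * (x i ^ (r + 1) * Real.exp (-(a * x i))))
    (by positivity) (fun i ↦ abs_censored_expansion_le ha hb (hx i) r) n
  convert h using 2
  simp only [empMoment, Finset.sum_add_distrib, Finset.sum_sub_distrib, ← Finset.mul_sum]
  ring

/-- Along a sequence of rates `b n → a`, the empirical moments have a first-order expansion
at `a`. -/
lemma empMoment_expansion_isLittleO {x : ℕ → ℝ} (hx : ∀ i, 0 ≤ x i) {a : ℝ} (ha : 0 < a)
    {b : ℕ → ℝ} (hb : Tendsto b atTop (𝓝 a)) (r : ℕ) :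
    (fun n ↦ empMoment x n r (b n) - empMoment x n r a + (b n - a) * empMoment x n (r + 1) a)
      =o[atTop] fun n ↦ b n - a := by
  have h0 : Tendsto (fun n ↦ b n - a) atTop (𝓝 0) := by simpa using hb.sub_const a
  have hbd : ∀ᶠ n in atTop, |b n - a| ≤ a / 2 := by
    have := h0.abs.eventually_le_const (show |(0 : ℝ)| < a / 2 by simpa using by positivity)
    exact this
  have hO : (fun n ↦ empMoment x n r (b n) - empMoment x n r a
      + (b n - a) * empMoment x n (r + 1) a) =O[atTop] fun n ↦ (b n - a) ^ 2 := by
    refine Asymptotics.IsBigO.of_bound ((r + 2).factorial / (a / 2) ^ (r + 2)) ?_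
    filter_upwards [hbd] with n hn
    rw [Real.norm_eq_abs, Real.norm_of_nonneg (sq_nonneg (b n - a))]
    exact abs_empMoment_expansion_le hx ha hn n r
  refine hO.trans_isLittleO ?_
  have h1 : (fun n ↦ b n - a) =o[atTop] fun _ ↦ (1 : ℝ) := (Asymptotics.isLittleO_one_iff ℝ).2 h0
  simpa [pow_two] using (Asymptotics.isBigO_refl (fun n ↦ b n - a) atTop).mul_isLittleO h1

lemma tendsto_empMoment_of_tendsto {x : ℕ → ℝ} (hx : ∀ i, 0 ≤ x i) {a m : ℝ} (ha : 0 < a)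
    {b : ℕ → ℝ} (hb : Tendsto b atTop (𝓝 a)) (r : ℕ)
    (hm : Tendsto (fun n ↦ empMoment x n r a) atTop (𝓝 m)) :
    Tendsto (fun n ↦ empMoment x n r (b n)) atTop (𝓝 m) := by
  have h0 : Tendsto (fun n ↦ b n - a) atTop (𝓝 0) := by simpa using hb.sub_const a
  have hbdd : (fun n ↦ empMoment x n (r + 1) a) =O[atTop] fun _ ↦ (1 : ℝ) := by
    refine Asymptotics.IsBigO.of_bound ((r + 1).factorial / a ^ (r + 1)) (.of_forall fun n ↦ ?_)
    rw [norm_one, mul_one]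
    refine abs_mean_le (by positivity) (fun i ↦ ?_) n
    rw [abs_of_nonneg (mul_nonneg (pow_nonneg (hx i) _) (Real.exp_nonneg _))]
    exact pow_mul_exp_le ha (hx i) _
  have h1 := (empMoment_expansion_isLittleO hx ha hb r).trans_tendsto h0
  have h2 : Tendsto (fun n ↦ (b n - a) * empMoment x n (r + 1) a) atTop (𝓝 0) := by
    have := (Asymptotics.isBigO_refl (fun n ↦ b n - a) atTop).mul hbdd
    simp only [mul_one] at this
    exact this.trans_tendsto h0
  have := (h1.sub h2).add hm
  simp only [sub_zero, zero_add] at this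
  refine this.congr fun n ↦ ?_
  ring

/-! ### The censoring rate -/

lemma invAt_spec {L : ℝ → ℝ} (h : ∃ s, 0 < s ∧ L s = Real.exp (-1)) :
    0 < invAt L ∧ L (invAt L) = Real.exp (-1) := by
  obtain ⟨s, hs, hL⟩ := h
  have : ∃ t ∈ Set.Ioi (0 : ℝ), L t = Real.exp (-1) := ⟨s, hs, hL⟩
  exact ⟨Function.invFunOn_mem this, Function.invFunOn_eq this⟩

lemma empLaplace_lt_empLaplace {x : ℕ → ℝ} (hx : ∀ i, 0 < x i) {n : ℕ} (hn : 1 ≤ n) {s t : ℝ}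
    (hst : s < t) : empLaplace x n t < empLaplace x n s := by
  have hn' : (0 : ℝ) < n := by exact_mod_cast hn
  unfold empLaplace
  refine mul_lt_mul_of_pos_left (Finset.sum_lt_sum_of_nonempty ⟨0, Finset.mem_range.2 hn⟩ ?_)
    (by positivity)
  intro i _
  have := mul_lt_mul_of_pos_right hst (hx i)
  exact Real.exp_lt_exp.2 (by linarith)

lemma exists_empLaplace_eq {x : ℕ → ℝ} (hx : ∀ i, 0 < x i) {n : ℕ} (hn : 1 ≤ n) :
    ∃ s, 0 < s ∧ empLaplace x n s = Real.exp (-1) := by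
  have hn' : (n : ℝ) ≠ 0 := by positivity
  have hcont : Continuous (empLaplace x n) := by unfold empLaplace; fun_prop
  have h0 : empLaplace x n 0 = 1 := by simp [empLaplace, hn']
  have hlim : Tendsto (empLaplace x n) atTop (𝓝 0) := by
    have : Tendsto (fun s ↦ (1 / (n : ℝ)) * ∑ i ∈ Finset.range n, Real.exp (-(s * x i))) atTop
        (𝓝 ((1 / (n : ℝ)) * ∑ i ∈ Finset.range n, 0)) := by
      refine (tendsto_finsetSum _ fun i _ ↦ ?_).const_mul _
      exact Real.tendsto_exp_neg_atTop_nhds_zero.comp (tendsto_id.atTop_mul_const (hx i))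
    simpa only [Finset.sum_const_zero, mul_zero] using! this
  obtain ⟨T, hT0, hT⟩ := ((eventually_ge_atTop (0 : ℝ)).and
    (hlim.eventually_lt_const (Real.exp_pos (-1)))).exists
  have he : Real.exp (-1) < 1 := by simp
  obtain ⟨s, hs, hse⟩ := intermediate_value_Icc' hT0 hcont.continuousOn
    ⟨hT.le, (by rw [h0]; exact he.le : Real.exp (-1) ≤ empLaplace x n 0)⟩
  refine ⟨s, lt_of_le_of_ne hs.1 ?_, hse⟩
  rintro rfl
  exact he.ne (hse.symm.trans h0)

lemma rateEst_pos {x : ℕ → ℝ} (hx : ∀ i, 0 < x i) {n : ℕ} (hn : 1 ≤ n) : 0 < rateEst x n :=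
  (invAt_spec (exists_empLaplace_eq hx hn)).1

lemma empLaplace_rateEst {x : ℕ → ℝ} (hx : ∀ i, 0 < x i) {n : ℕ} (hn : 1 ≤ n) :
    empLaplace x n (rateEst x n) = Real.exp (-1) :=
  (invAt_spec (exists_empLaplace_eq hx hn)).2

lemma lt_rateEst_iff {x : ℕ → ℝ} (hx : ∀ i, 0 < x i) {n : ℕ} (hn : 1 ≤ n) (t : ℝ) :
    t < rateEst x n ↔ Real.exp (-1) < empLaplace x n t := by
  have hanti : StrictAnti (empLaplace x n) := fun s t h ↦ empLaplace_lt_empLaplace hx hn h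
  rw [← empLaplace_rateEst hx hn, hanti.lt_iff_gt]

lemma rateEst_lt_iff {x : ℕ → ℝ} (hx : ∀ i, 0 < x i) {n : ℕ} (hn : 1 ≤ n) (t : ℝ) :
    rateEst x n < t ↔ empLaplace x n t < Real.exp (-1) := by
  have hanti : StrictAnti (empLaplace x n) := fun s t h ↦ empLaplace_lt_empLaplace hx hn h
  rw [← empLaplace_rateEst hx hn, hanti.lt_iff_gt]

lemma eq_rateEst {x : ℕ → ℝ} (hx : ∀ i, 0 < x i) {n : ℕ} (hn : 1 ≤ n) {b : ℝ}
    (hb : empLaplace x n b = Real.exp (-1)) : b = rateEst x n := by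
  have hanti : StrictAnti (empLaplace x n) := fun s t h ↦ empLaplace_lt_empLaplace hx hn h
  exact hanti.injective (hb.trans (empLaplace_rateEst hx hn).symm)

/-- Consistency of the censoring rate: if the empirical transforms converge at all positive
rationals to a function that crosses the level `exp (-1)` downwards at `a`, then their crossing
points converge to `a`. -/
lemma tendsto_rateEst {x : ℕ → ℝ} (hx : ∀ i, 0 < x i) {L : ℝ → ℝ} {a : ℝ} (ha : 0 < a)
    (hlt : ∀ s, 0 < s → s < a → Real.exp (-1) < L s) (hgt : ∀ s, a < s → L s < Real.exp (-1))
    (hL : ∀ q : ℚ, 0 < q → Tendsto (fun n ↦ empLaplace x n q) atTop (𝓝 (L q))) :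
    Tendsto (rateEst x) atTop (𝓝 a) := by
  refine tendsto_order.2 ⟨fun u hu ↦ ?_, fun u hu ↦ ?_⟩
  · obtain ⟨q, hq, hqa⟩ := exists_rat_btwn (max_lt hu ha)
    have hq0 : (0 : ℝ) < q := (le_max_right u 0).trans_lt hq
    filter_upwards [(hL q (by exact_mod_cast hq0)).eventually_const_lt (hlt q hq0 hqa),
      eventually_ge_atTop 1] with n hn hn1
    exact ((le_max_left u 0).trans_lt hq).trans ((lt_rateEst_iff hx hn1 _).2 hn)
  · obtain ⟨q, hq, hqu⟩ := exists_rat_btwn hu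
    have hq0 : (0 : ℝ) < q := ha.trans hq
    filter_upwards [(hL q (by exact_mod_cast hq0)).eventually_lt_const (hgt q hq),
      eventually_ge_atTop 1] with n hn hn1
    exact ((rateEst_lt_iff hx hn1 _).2 hn).trans hqu

/-! ### First-order expansion of the estimators -/

open Asymptotics in
/-- The censoring rate is asymptotically linear in the fluctuation of the empirical Laplace
transform at `a`. -/
lemma rateEst_sub_isEquivalent {x : ℕ → ℝ} (hx : ∀ i, 0 < x i) {a m₁ : ℝ} (ha : 0 < a)
    (hA : Tendsto (rateEst x) atTop (𝓝 a)) (hm₁ : m₁ ≠ 0)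
    (h₁ : Tendsto (fun n ↦ empMoment x n 1 a) atTop (𝓝 m₁)) :
    (fun n ↦ rateEst x n - a) ~[atTop] fun n ↦ (empLaplace x n a - Real.exp (-1)) / m₁ := by
  refine IsEquivalent.symm ?_
  have e := empMoment_expansion_isLittleO (fun i ↦ (hx i).le) ha hA 0
  have h1 : (fun n ↦ (rateEst x n - a) * (empMoment x n 1 a - m₁))
      =o[atTop] fun n ↦ rateEst x n - a := by
    have : (fun n ↦ empMoment x n 1 a - m₁) =o[atTop] fun _ ↦ (1 : ℝ) :=
      (isLittleO_one_iff ℝ).2 (by simpa using h₁.sub_const m₁)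
    simpa using (isBigO_refl (fun n ↦ rateEst x n - a) atTop).mul_isLittleO this
  refine ((h1.sub e).const_mul_left m₁⁻¹).congr' ?_ EventuallyEq.rfl
  filter_upwards [eventually_ge_atTop 1] with n hn
  simp only [Pi.sub_apply, empMoment_zero, empLaplace_rateEst hx hn, zero_add]
  field_simp
  ring

open Asymptotics in
/-- Since `a` is a critical point of `s ↦ s * E[X * exp (-s * X)]`, that is since `m₁ = a * m₂`,
replacing `a` by the random rate does not affect the estimator of `γ` to first order. -/
lemma gammaEst_sub_isLittleO {x : ℕ → ℝ} (hx : ∀ i, 0 < x i) {a m₁ m₂ : ℝ} (ha : 0 < a)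
    (hA : Tendsto (rateEst x) atTop (𝓝 a)) (hm₂ : a * m₂ = m₁)
    (h₁ : Tendsto (fun n ↦ empMoment x n 1 a) atTop (𝓝 m₁))
    (h₂ : Tendsto (fun n ↦ empMoment x n 2 a) atTop (𝓝 m₂)) :
    (fun n ↦ gammaEst x n - Real.exp 1 * a * empMoment x n 1 a)
      =o[atTop] fun n ↦ rateEst x n - a := by
  have e := empMoment_expansion_isLittleO (fun i ↦ (hx i).le) ha hA 1
  have h1 := (hA.isBigO_one ℝ).mul_isLittleO e
  have h2 : (fun n ↦ (empMoment x n 1 a - rateEst x n * empMoment x n 2 a) * (rateEst x n - a))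
      =o[atTop] fun n ↦ 1 * (rateEst x n - a) := by
    refine IsLittleO.mul_isBigO ((isLittleO_one_iff ℝ).2 ?_) (isBigO_refl _ _)
    simpa [hm₂] using h₁.sub (hA.mul h₂)
  refine ((h1.add h2).const_mul_left (Real.exp 1)).congr (fun n ↦ ?_) fun n ↦ one_mul _
  simp only [gammaEst]
  ring

lemma tendsto_gammaEst {x : ℕ → ℝ} (hx : ∀ i, 0 < x i) {a m₁ : ℝ} (ha : 0 < a)
    (hA : Tendsto (rateEst x) atTop (𝓝 a))
    (h₁ : Tendsto (fun n ↦ empMoment x n 1 a) atTop (𝓝 m₁)) :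
    Tendsto (gammaEst x) atTop (𝓝 (Real.exp 1 * m₁ * a)) :=
  ((tendsto_empMoment_of_tendsto (fun i ↦ (hx i).le) ha hA 1 h₁).const_mul _).mul hA

lemma tendsto_lambdaEst {x : ℕ → ℝ} {a γ : ℝ} (ha : 0 < a)
    (hA : Tendsto (rateEst x) atTop (𝓝 a)) (hg : Tendsto (gammaEst x) atTop (𝓝 γ)) :
    Tendsto (lambdaEst x) atTop (𝓝 (a ^ (-γ))) :=
  hA.rpow hg.neg (.inl ha.ne')

/-- The centred sample mean of the vectors `score a lam (x i)`. For a sample from `PS(γ, lam)` with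
`lam * a ^ γ = 1`, their expectation is `(γ, -lam * (γ * log a + 1))`. -/
noncomputable def scoreFluct (x : ℕ → ℝ) (γ lam a : ℝ) (n : ℕ) : EuclideanSpace ℝ (Fin 2) :=
  !₂[sampleMean (fun i ↦ score a lam (x i) 0) n - γ,
    sampleMean (fun i ↦ score a lam (x i) 1) n + lam * (γ * Real.log a + 1)]

lemma sampleMean_score_zero (x : ℕ → ℝ) (a lam : ℝ) (n : ℕ) :
    sampleMean (fun i ↦ score a lam (x i) 0) n = Real.exp 1 * a * empMoment x n 1 a := by
  simp only [sampleMean, score, empMoment, Matrix.cons_val_zero, Finset.mul_sum, pow_one]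
  refine Finset.sum_congr rfl fun i _ ↦ ?_
  rw [sub_eq_add_neg, Real.exp_add]
  ring

lemma sampleMean_score_one (x : ℕ → ℝ) (a lam : ℝ) (n : ℕ) :
    sampleMean (fun i ↦ score a lam (x i) 1) n =
      -lam * Real.exp 1 * (a * Real.log a * empMoment x n 1 a + empLaplace x n a) := by
  simp only [sampleMean, score, empMoment, empLaplace, Matrix.cons_val_one,
    Finset.mul_sum, pow_one, ← Finset.sum_add_distrib, Matrix.cons_val_fin_one]
  refine Finset.sum_congr rfl fun i _ ↦ ?_
  rw [sub_eq_add_neg, Real.exp_add]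
  ring

lemma isLittleO_vec2 {f g : ℕ → ℝ} {T : ℕ → EuclideanSpace ℝ (Fin 2)}
    (hf : f =o[atTop] T) (hg : g =o[atTop] T) :
    (fun n ↦ (!₂[f n, g n] : EuclideanSpace ℝ (Fin 2))) =o[atTop] T := by
  have key (h : ℕ → ℝ) (hh : h =o[atTop] T) (v : EuclideanSpace ℝ (Fin 2)) :
      (fun n ↦ h n • v) =o[atTop] T := by
    refine (Asymptotics.IsBigO.of_bound ‖v‖ (.of_forall fun n ↦ ?_)).trans_isLittleO hh
    rw [norm_smul, mul_comm]
  refine ((key f hf !₂[1, 0]).add (key g hg !₂[0, 1])).congr_left fun n ↦ ?_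
  ext i
  fin_cases i <;> simp

open Asymptotics in
/-- Asymptotic linearity of the pair of estimators: its error is equivalent to the fluctuation of
the sample mean of the vectors `score`. -/
lemma estimators_isEquivalent {x : ℕ → ℝ} (hx : ∀ i, 0 < x i) {a m₁ m₂ γ lam : ℝ} (ha : 0 < a)
    (hγ : 0 < γ) (hlam : a ^ (-γ) = lam)
    (hA : Tendsto (rateEst x) atTop (𝓝 a)) (hm₁ : Real.exp 1 * m₁ * a = γ) (hm₂ : a * m₂ = m₁)
    (h₁ : Tendsto (fun n ↦ empMoment x n 1 a) atTop (𝓝 m₁))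
    (h₂ : Tendsto (fun n ↦ empMoment x n 2 a) atTop (𝓝 m₂)) :
    (fun n ↦ (!₂[gammaEst x n - γ, lambdaEst x n - lam] : EuclideanSpace ℝ (Fin 2)))
      ~[atTop] scoreFluct x γ lam a := by
  have hm₁0 : m₁ ≠ 0 := by rintro rfl; simp at hm₁; exact hγ.ne hm₁
  have hlam0 : 0 < lam := hlam ▸ Real.rpow_pos_of_pos ha _
  have hg : Tendsto (gammaEst x) atTop (𝓝 γ) := hm₁ ▸ tendsto_gammaEst hx ha hA h₁
  set T := scoreFluct x γ lam a with hT
  set ν : ℕ → ℝ := fun n ↦ Real.exp 1 * a * empMoment x n 1 a - γ with hν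
  set δ : ℕ → ℝ := fun n ↦ empLaplace x n a - Real.exp (-1) with hδ
  have he : Real.exp 1 * Real.exp (-1) = 1 := by rw [← Real.exp_add]; simp
  have hT0 n : T n 0 = ν n := by
    simp [hT, scoreFluct, sampleMean_score_zero, hν]
  have hT1 n : T n 1 = -lam * (Real.log a * ν n + Real.exp 1 * δ n) := by
    simp only [hT, scoreFluct, sampleMean_score_one, hν, hδ]
    simp
    linear_combination -lam * he
  have hTi (i : Fin 2) : (fun n ↦ T n i) =O[atTop] T :=
    .of_bound 1 (.of_forall fun n ↦ by simpa using PiLp.norm_apply_le (T n) i)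
  have hνT : ν =O[atTop] T := (hTi 0).congr_left hT0
  have hδT : δ =O[atTop] T := by
    have := (((hTi 1).const_mul_left (-lam⁻¹)).sub ((hTi 0).const_mul_left (Real.log a)))
    refine (this.const_mul_left (Real.exp (-1))).congr_left fun n ↦ ?_
    rw [hT0, hT1]
    field_simp
    linear_combination δ n * he
  have hequiv := rateEst_sub_isEquivalent hx ha hA hm₁0 h₁
  have hAδ : (fun n ↦ rateEst x n - a) =O[atTop] δ := by
    refine hequiv.isBigO.trans ?_
    simpa only [div_eq_inv_mul] using (isBigO_refl δ atTop).const_mul_left m₁⁻¹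
  have hAT := hAδ.trans hδT
  -- the error of the estimator of `γ`
  have r₁ : (fun n ↦ gammaEst x n - γ - ν n) =o[atTop] T :=
    ((gammaEst_sub_isLittleO hx ha hA hm₂ h₁ h₂).trans_isBigO hAT).congr_left
      fun n ↦ by simp only [hν]; ring
  have hgT : (fun n ↦ gammaEst x n - γ) =O[atTop] T :=
    (r₁.isBigO.add hνT).congr_left fun n ↦ by ring
  -- the error of the estimator of `lam`, by differentiability of `(s, g) ↦ s ^ (-g)`
  have hd := ((Real.hasStrictFDerivAt_rpow_of_pos (a, -γ) ha).hasFDerivAt).isLittleO.comp_tendsto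
    (show Tendsto (fun n ↦ (rateEst x n, -gammaEst x n)) atTop (𝓝 (a, -γ)) from
      hA.prodMk_nhds hg.neg)
  have hd' : (fun n ↦ lambdaEst x n - lam - (-γ * a ^ (-γ - 1) * (rateEst x n - a)
      - lam * Real.log a * (gammaEst x n - γ))) =o[atTop] T := by
    refine (hd.trans_isBigO ?_).congr_left fun n ↦ ?_
    · refine IsBigO.prod_left hAT (hgT.neg_left.congr_left fun n ↦ ?_)
      simp
      ring
    · simp [lambdaEst, hlam]
      ring
  have hpow : a ^ (-γ - 1) = lam / a := by
    rw [Real.rpow_sub ha, Real.rpow_one, hlam]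
  have r₂ : (fun n ↦ lambdaEst x n - lam - T n 1) =o[atTop] T := by
    have hs : (fun n ↦ rateEst x n - a - δ n / m₁) =o[atTop] T :=
      hequiv.isLittleO.trans_isBigO (by
        simpa only [div_eq_inv_mul] using hδT.const_mul_left m₁⁻¹)
    refine ((hd'.add (hs.const_mul_left (-γ * (lam / a)))).add
      (r₁.const_mul_left (-lam * Real.log a))).congr_left fun n ↦ ?_
    rw [hT1, hpow]
    have : γ / m₁ = Real.exp 1 * a := by rw [← hm₁]; field_simp
    have h3 : γ * (lam / a) * (δ n / m₁) = lam * Real.exp 1 * δ n := by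
      rw [show γ * (lam / a) * (δ n / m₁) = γ / m₁ * (lam / a) * δ n by ring, this]
      field_simp
    linear_combination h3
  refine (isLittleO_vec2 r₁ r₂).congr_left fun n ↦ ?_
  ext i
  fin_cases i <;> simp [hT0]

/-! ### Weak convergence -/

section WeakConvergence

variable {Ω Ω' : Type*} [MeasurableSpace Ω] [MeasurableSpace Ω'] {P : Measure Ω}
  {P' : Measure Ω'} [IsProbabilityMeasure P] [IsProbabilityMeasure P']

open Asymptotics in
/-- A form of Slutsky's theorem: almost surely equivalent sequences of random vectors have the same
limit in distribution. -/
lemma tendstoInDistribution_of_isEquivalent {E : Type*} [NormedAddCommGroup E] [NormedSpace ℝ E]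
    [MeasurableSpace E] [BorelSpace E] [SecondCountableTopology E] {T Y : ℕ → Ω → E} {Z : Ω' → E}
    (hT : TendstoInDistribution T atTop Z (fun _ ↦ P) P') (hY : ∀ n, AEMeasurable (Y n) P)
    (h : ∀ᵐ ω ∂P, (fun n ↦ Y n ω) ~[atTop] fun n ↦ T n ω) :
    TendstoInDistribution Y atTop Z (fun _ ↦ P) P' := by
  have hTm := hT.forall_aemeasurable
  -- the relative error of `Y n`, which vanishes where `T n` does
  let q : ℕ → Ω → E := fun n ω ↦ ‖T n ω‖⁻¹ • (Y n ω - T n ω)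
  have hq : ∀ n, AEMeasurable (q n) P := fun n ↦
    (hTm n).norm.inv.smul ((hY n).sub (hTm n))
  have hq0 : TendstoInMeasure P q atTop (fun _ ↦ (0 : E)) := by
    refine tendstoInMeasure_of_tendsto_ae (fun n ↦ (hq n).aestronglyMeasurable) ?_
    filter_upwards [h] with ω hω
    have := hω.isLittleO.norm_right.norm_left.tendsto_div_nhds_zero
    refine tendsto_zero_iff_norm_tendsto_zero.2 (this.congr fun n ↦ ?_)
    simp [q, norm_smul, div_eq_inv_mul]
  have := hT.continuous_comp_prodMk_of_tendstoInMeasure_const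
    (g := fun p : E × E ↦ p.1 + ‖p.1‖ • p.2) (by fun_prop) hq0 hq
  refine (tendstoInDistribution_of_tendstoInMeasure_sub (X := fun n ω ↦ T n ω + ‖T n ω‖ • q n ω)
    Y Z (by simpa using this) ?_ hY)
  refine tendstoInMeasure_of_tendsto_ae (fun n ↦ ?_) ?_
  · exact ((hY n).sub ((hTm n).add ((hTm n).norm.smul (hq n)))).aestronglyMeasurable
  · filter_upwards [h] with ω hω
    refine tendsto_const_nhds.congr' ?_
    filter_upwards [hω.isLittleO.def one_pos] with n hn
    simp only [Pi.sub_apply, Pi.zero_apply, q]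
    by_cases h0 : T n ω = 0
    · simp [h0] at hn ⊢
      exact hn.symm
    · rw [smul_inv_smul₀ (norm_ne_zero_iff.2 h0)]
      simp

open scoped RealInnerProductSpace in
/-- The **multivariate central limit theorem**, reduced to the real one by taking inner products
(the Cramér-Wold device). -/
lemma tendstoInDistribution_multivariate {ι : Type*} [Fintype ι] [DecidableEq ι]
    {Z : ℕ → Ω → EuclideanSpace ℝ ι} (hZ : ∀ j, MemLp (fun ω ↦ Z 0 ω j) 2 P)
    (hindep : iIndepFun Z P) (hident : ∀ i, IdentDistrib (Z i) (Z 0) P P)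
    {μ : EuclideanSpace ℝ ι} (hμ : ∀ j, ∫ ω, Z 0 ω j ∂P = μ j)
    {C : Matrix ι ι ℝ} (hC : ∀ j k, C j k = cov[fun ω ↦ Z 0 ω j, fun ω ↦ Z 0 ω k; P]) :
    TendstoInDistribution
      (fun (n : ℕ) ω ↦ (√n : ℝ)⁻¹ • (∑ k ∈ Finset.range n, Z k ω - (n : ℝ) • μ))
      atTop id (fun _ ↦ P) (multivariateGaussian 0 C) := by
  have hvar (t : EuclideanSpace ℝ ι) : Var[fun ω ↦ ⟪Z 0 ω, t⟫; P] = t ⬝ᵥ C.mulVec t := by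
    have : (fun ω ↦ ⟪Z 0 ω, t⟫) = fun ω ↦ ∑ j, t j * Z 0 ω j := by
      ext ω; simp [PiLp.inner_apply]
    rw [this, variance_fun_sum' fun j _ ↦ (hZ j).const_mul (t j)]
    simp only [dotProduct, Matrix.mulVec, Finset.mul_sum]
    refine Finset.sum_congr rfl fun j _ ↦ Finset.sum_congr rfl fun k _ ↦ ?_
    rw [covariance_const_mul_left, covariance_const_mul_right, hC]
    ring
  have hpsd : C.PosSemidef := by
    refine Matrix.PosSemidef.of_dotProduct_mulVec_nonneg ?_ fun t ↦ ?_
    · ext j k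
      simp [hC, covariance_comm]
    · have := hvar (WithLp.toLp 2 t)
      simp only [star_trivial]
      exact this ▸ variance_nonneg _ _
  have hm (n : ℕ) : AEMeasurable
      (fun ω ↦ (√n : ℝ)⁻¹ • (∑ k ∈ Finset.range n, Z k ω - (n : ℝ) • μ)) P :=
    (((Finset.aemeasurable_fun_sum (Finset.range n) fun k _ ↦
      (hident k).aemeasurable_fst)).sub_const ((n : ℝ) • μ)).const_smul (√n : ℝ)⁻¹
  refine ⟨hm, by fun_prop, ProbabilityMeasure.tendsto_iff_tendsto_charFun.2 fun t ↦ ?_⟩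
  let W : ℕ → Ω → ℝ := fun k ω ↦ ⟪Z k ω, t⟫
  have hW0 : MemLp (W 0) 2 P := by
    have : W 0 = fun ω ↦ ∑ j, t j * Z 0 ω j := by
      ext ω; simp [W, PiLp.inner_apply]
    rw [this]
    exact memLp_finsetSum _ fun j _ ↦ (hZ j).const_mul (t j)
  have hWmean : P[W 0] = ⟪μ, t⟫ := by
    have : W 0 = fun ω ↦ ∑ j, t j * Z 0 ω j := by
      ext ω; simp [W, PiLp.inner_apply]
    rw [this, integral_finsetSum _ fun j _ ↦ ((hZ j).integrable (by norm_num)).const_mul (t j)]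
    simp [integral_const_mul, hμ, PiLp.inner_apply]
  have hmeas : Measurable fun z : EuclideanSpace ℝ ι ↦ ⟪z, t⟫ := by fun_prop
  have clt := tendstoInDistribution_inv_sqrt_mul_sum_sub (P := P) (X := W)
    (P' := gaussianReal 0 Var[W 0; P].toNNReal) (Y := id) HasLaw.id hW0
    (hindep.comp (fun _ z ↦ ⟪z, t⟫) fun _ ↦ hmeas) (fun i ↦ (hident i).comp hmeas)
  have := ProbabilityMeasure.tendsto_iff_tendsto_charFun.1 clt.tendsto 1
  simp only [ProbabilityMeasure.coe_mk, Measure.map_id] at this ⊢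
  rw [charFun_gaussianReal] at this
  rw [charFun_multivariateGaussian hpsd, ← hvar]
  convert this using 2 with n
  · rw [charFun_apply, charFun_apply_real, integral_map (hm n) (by fun_prop),
      integral_map (clt.forall_aemeasurable n) (by fun_prop)]
    refine integral_congr_ae (.of_forall fun ω ↦ ?_)
    simp only [W]
    rw [real_inner_smul_left, inner_sub_left, sum_inner, real_inner_smul_left, hWmean]
    simp
  · simp [W, Real.coe_toNNReal _ (variance_nonneg _ _)]

end WeakConvergence

/-! ### Moments of a positive stable law -/

section Moments

variable {Ω : Type*} [MeasurableSpace Ω] {P : Measure Ω} {X : Ω → ℝ} {γ lam : ℝ}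

/-- The censored moment `E[X ^ r * exp (-(s * X))]`, the population counterpart of `empMoment`. -/
noncomputable def censoredMoment (X : Ω → ℝ) (P : Measure Ω) (r : ℕ) (s : ℝ) : ℝ :=
  ∫ ω, X ω ^ r * Real.exp (-(s * X ω)) ∂P

lemma censoredMoment_zero (s : ℝ) : censoredMoment X P 0 s = laplace X P s := by
  simp [censoredMoment, laplace]

lemma ae_norm_censored_le (h0 : ∀ᵐ ω ∂P, 0 ≤ X ω) {s : ℝ} (hs : 0 < s) (r : ℕ) :
    ∀ᵐ ω ∂P, ‖X ω ^ r * Real.exp (-(s * X ω))‖ ≤ r.factorial / s ^ r := by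
  filter_upwards [h0] with ω hω
  rw [Real.norm_of_nonneg (by positivity)]
  exact pow_mul_exp_le hs hω r

lemma memLp_censored [IsFiniteMeasure P] (hX : AEMeasurable X P) (h0 : ∀ᵐ ω ∂P, 0 ≤ X ω) {s : ℝ}
    (hs : 0 < s) (r : ℕ) (p : ENNReal) :
    MemLp (fun ω ↦ X ω ^ r * Real.exp (-(s * X ω))) p P :=
  .of_bound (AEMeasurable.aestronglyMeasurable (by fun_prop)) _ (ae_norm_censored_le h0 hs r)

lemma integrable_censored [IsFiniteMeasure P] (hX : AEMeasurable X P) (h0 : ∀ᵐ ω ∂P, 0 ≤ X ω)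
    {s : ℝ} (hs : 0 < s) (r : ℕ) : Integrable (fun ω ↦ X ω ^ r * Real.exp (-(s * X ω))) P :=
  memLp_one_iff_integrable.1 (memLp_censored hX h0 hs r 1)

lemma hasDerivAt_censoredMoment [IsFiniteMeasure P] (hX : AEMeasurable X P)
    (h0 : ∀ᵐ ω ∂P, 0 ≤ X ω) {s : ℝ} (hs : 0 < s) (r : ℕ) :
    HasDerivAt (censoredMoment X P r) (-censoredMoment X P (r + 1) s) s := by
  have hmem : -s ∈ interior (integrableExpSet X P) := by
    refine mem_interior.2 ⟨Set.Iio 0, fun t ht ↦ ?_, isOpen_Iio, by simpa using hs⟩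
    have := integrable_censored hX h0 (neg_pos.2 ht) 0
    simpa [integrableExpSet] using this
  have := (hasDerivAt_integral_pow_mul_exp_real hmem r).comp s (hasDerivAt_neg s)
  simpa [censoredMoment, Function.comp_def, neg_mul] using! this

namespace HasPSLaw

lemma laplace_lt_laplace (hX : HasPSLaw X γ lam P) (hγ : 0 < γ) (hlam : 0 < lam) {s t : ℝ}
    (hs : 0 ≤ s) (hst : s < t) : laplace X P t < laplace X P s := by
  rw [hX.laplace_eq s hs, hX.laplace_eq t (hs.trans hst.le)]
  gcongr

lemma invAt_laplace_spec (hX : HasPSLaw X γ lam P) (hγ : 0 < γ) (hlam : 0 < lam) :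
    0 < invAt (laplace X P) ∧ laplace X P (invAt (laplace X P)) = Real.exp (-1) := by
  have h : 0 < lam⁻¹ ^ γ⁻¹ := by positivity
  refine invAt_spec ⟨lam⁻¹ ^ γ⁻¹, h, ?_⟩
  rw [hX.laplace_eq _ h.le, ← Real.rpow_mul (by positivity), inv_mul_cancel₀ hγ.ne', Real.rpow_one,
    mul_inv_cancel₀ hlam.ne']

lemma mul_rpow_eq_one (hX : HasPSLaw X γ lam P) {a : ℝ} (ha : 0 < a)
    (h : laplace X P a = Real.exp (-1)) : lam * a ^ γ = 1 := by
  rw [hX.laplace_eq a ha.le, Real.exp_eq_exp] at h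
  linarith

variable [IsProbabilityMeasure P]

/-- A positive stable variable has no atom at `0`, because its Laplace transform vanishes at
infinity. -/
lemma ae_pos (hX : HasPSLaw X γ lam P) (hγ : 0 < γ) (hlam : 0 < lam) : ∀ᵐ ω ∂P, 0 < X ω := by
  have hle (s : ℝ) (hs : 0 < s) : P.real {ω | X ω = 0} ≤ Real.exp (-(lam * s ^ γ)) := by
    have hint : Integrable (fun ω ↦ Real.exp (-(s * X ω))) P := by
      simpa using integrable_censored hX.aemeasurable hX.nonneg hs 0
    have h := mul_meas_ge_le_integral_of_nonneg (.of_forall fun ω ↦ Real.exp_nonneg _) hint 1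
    rw [one_mul] at h
    rw [← hX.laplace_eq s hs.le]
    refine le_trans (measureReal_mono fun ω hω ↦ ?_) h
    simp only [Set.mem_ofPred_eq] at hω ⊢
    simp [hω]
  have hlim : Tendsto (fun s : ℝ ↦ Real.exp (-(lam * s ^ γ))) atTop (𝓝 0) :=
    Real.tendsto_exp_neg_atTop_nhds_zero.comp ((tendsto_rpow_atTop hγ).const_mul_atTop hlam)
  have hzero : P.real {ω | X ω = 0} ≤ 0 :=
    ge_of_tendsto hlim ((eventually_gt_atTop 0).mono hle)
  have : P {ω | X ω = 0} = 0 :=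
    (measureReal_eq_zero_iff).1 (le_antisymm hzero measureReal_nonneg)
  filter_upwards [hX.nonneg, measure_eq_zero_iff_ae_notMem.1 this] with ω h1 h2
  exact lt_of_le_of_ne h1 (Ne.symm h2)

lemma censoredMoment_one (hX : HasPSLaw X γ lam P) {s : ℝ} (hs : 0 < s) :
    censoredMoment X P 1 s = lam * (γ * s ^ (γ - 1)) * Real.exp (-(lam * s ^ γ)) := by
  have h1 := hasDerivAt_censoredMoment hX.aemeasurable hX.nonneg hs 0
  have h2 : HasDerivAt (fun s : ℝ ↦ Real.exp (-(lam * s ^ γ))) _ s :=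
    (((Real.hasDerivAt_rpow_const (p := γ) (.inl hs.ne')).const_mul lam).neg).exp
  have h3 := h1.congr_of_eventuallyEq (f₁ := fun s : ℝ ↦ Real.exp (-(lam * s ^ γ))) <| by
    filter_upwards [eventually_gt_nhds hs] with t ht
    rw [censoredMoment_zero, hX.laplace_eq t ht.le]
  have := h3.unique h2
  simp only [zero_add, Pi.neg_apply] at this
  linarith

lemma mul_censoredMoment_one (hX : HasPSLaw X γ lam P) {s : ℝ} (hs : 0 < s) :
    s * censoredMoment X P 1 s = γ * (lam * s ^ γ * Real.exp (-(lam * s ^ γ))) := by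
  rw [hX.censoredMoment_one hs, Real.rpow_sub_one hs.ne']
  field_simp

/-- The function `s ↦ s * E[X * exp (-s * X)]` is critical at the point where the Laplace
transform equals `exp (-1)`. -/
lemma mul_censoredMoment_two (hX : HasPSLaw X γ lam P) {a : ℝ} (ha : 0 < a)
    (hla : lam * a ^ γ = 1) : a * censoredMoment X P 2 a = censoredMoment X P 1 a := by
  have h1 := (hasDerivAt_id a).mul (hasDerivAt_censoredMoment hX.aemeasurable hX.nonneg ha 1)
  have hu := (Real.hasDerivAt_rpow_const (p := γ) (.inl ha.ne')).const_mul lam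
  have h2 : HasDerivAt (fun s : ℝ ↦ γ * (lam * s ^ γ * Real.exp (-(lam * s ^ γ)))) _ a :=
    (hu.mul hu.neg.exp).const_mul γ
  have h3 := h1.congr_of_eventuallyEq
    (f₁ := fun s : ℝ ↦ γ * (lam * s ^ γ * Real.exp (-(lam * s ^ γ)))) <| by
      filter_upwards [eventually_gt_nhds ha] with t ht
      exact (hX.mul_censoredMoment_one ht).symm
  have := h3.unique h2
  simp only [Pi.neg_apply, hla, id_eq, one_mul] at this
  linear_combination -this

end HasPSLaw

/-- The coefficient of `x ^ r * exp (-(a * x))` in the component `j` of `score a lam x`. -/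
noncomputable def scoreCoeff (a lam : ℝ) (j r : Fin 2) : ℝ :=
  !![0, Real.exp 1 * a; -lam * Real.exp 1, -lam * Real.exp 1 * a * Real.log a] j r

lemma score_eq (a lam x : ℝ) (j : Fin 2) :
    score a lam x j = scoreCoeff a lam j 0 * (x ^ 0 * Real.exp (-(a * x))) +
      scoreCoeff a lam j 1 * (x ^ 1 * Real.exp (-(a * x))) := by
  fin_cases j <;> simp [score, scoreCoeff, sub_eq_add_neg, Real.exp_add] <;> ring

lemma score_mul_score (a lam x : ℝ) (j k : Fin 2) :
    score a lam x j * score a lam x k =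
      scoreCoeff a lam j 0 * scoreCoeff a lam k 0 * (x ^ 0 * Real.exp (-(2 * a * x))) +
      (scoreCoeff a lam j 0 * scoreCoeff a lam k 1 + scoreCoeff a lam j 1 * scoreCoeff a lam k 0) *
        (x ^ 1 * Real.exp (-(2 * a * x))) +
      scoreCoeff a lam j 1 * scoreCoeff a lam k 1 * (x ^ 2 * Real.exp (-(2 * a * x))) := by
  have : Real.exp (-(2 * a * x)) = Real.exp (-(a * x)) * Real.exp (-(a * x)) := by
    rw [← Real.exp_add]; ring_nf
  rw [score_eq, score_eq, this]
  ring

lemma tendsto_scoreCoeff {A l : ℕ → ℝ} {a lam : ℝ} (ha : 0 < a) (hA : Tendsto A atTop (𝓝 a))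
    (hl : Tendsto l atTop (𝓝 lam)) (j r : Fin 2) :
    Tendsto (fun n ↦ scoreCoeff (A n) (l n) j r) atTop (𝓝 (scoreCoeff a lam j r)) := by
  have hlog := hA.log ha.ne'
  have h1 := hl.neg.mul_const (Real.exp 1)
  fin_cases j <;> fin_cases r <;> simp [scoreCoeff]
  · exact hA.const_mul _
  · simpa using h1
  · simpa using (h1.mul hA).mul hlog

variable [IsProbabilityMeasure P]

lemma memLp_score (hX : AEMeasurable X P) (h0 : ∀ᵐ ω ∂P, 0 ≤ X ω) {a : ℝ} (ha : 0 < a) (lam : ℝ)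
    (j : Fin 2) (p : ENNReal) : MemLp (fun ω ↦ score a lam (X ω) j) p P := by
  simp only [score_eq]
  exact ((memLp_censored hX h0 ha 0 p).const_mul _).add ((memLp_censored hX h0 ha 1 p).const_mul _)

lemma integral_score (hX : AEMeasurable X P) (h0 : ∀ᵐ ω ∂P, 0 ≤ X ω) {a : ℝ} (ha : 0 < a)
    (lam : ℝ) (j : Fin 2) :
    ∫ ω, score a lam (X ω) j ∂P = scoreCoeff a lam j 0 * censoredMoment X P 0 a +
      scoreCoeff a lam j 1 * censoredMoment X P 1 a := by
  simp only [score_eq]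
  rw [integral_add ((integrable_censored hX h0 ha 0).const_mul _)
    ((integrable_censored hX h0 ha 1).const_mul _), integral_const_mul, integral_const_mul]
  rfl

lemma covMat_score (hX : AEMeasurable X P) (h0 : ∀ᵐ ω ∂P, 0 ≤ X ω) {a : ℝ} (ha : 0 < a)
    (lam : ℝ) (j k : Fin 2) :
    covMat (fun ω ↦ score a lam (X ω)) P j k =
      (scoreCoeff a lam j 0 * scoreCoeff a lam k 0 * censoredMoment X P 0 (2 * a) +
      (scoreCoeff a lam j 0 * scoreCoeff a lam k 1 + scoreCoeff a lam j 1 * scoreCoeff a lam k 0) *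
        censoredMoment X P 1 (2 * a) +
      scoreCoeff a lam j 1 * scoreCoeff a lam k 1 * censoredMoment X P 2 (2 * a)) -
      (scoreCoeff a lam j 0 * censoredMoment X P 0 a +
        scoreCoeff a lam j 1 * censoredMoment X P 1 a) *
      (scoreCoeff a lam k 0 * censoredMoment X P 0 a +
        scoreCoeff a lam k 1 * censoredMoment X P 1 a) := by
  have h2a : 0 < 2 * a := by positivity
  have i (r : ℕ) := integrable_censored hX h0 h2a r
  simp only [covMat, Matrix.of_apply]
  rw [covariance_eq_sub (memLp_score hX h0 ha lam j 2) (memLp_score hX h0 ha lam k 2),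
    integral_score hX h0 ha, integral_score hX h0 ha]
  simp only [Pi.mul_apply, score_mul_score]
  rw [integral_add (by exact ((i 0).const_mul _).add ((i 1).const_mul _)) ((i 2).const_mul _),
    integral_add ((i 0).const_mul _) ((i 1).const_mul _), integral_const_mul, integral_const_mul,
    integral_const_mul]
  rfl

end Moments

/-! ### The plug-in covariance matrix -/

lemma sampleMean_score (x : ℕ → ℝ) (n : ℕ) (a lam : ℝ) (j : Fin 2) :
    sampleMean (fun i ↦ score a lam (x i) j) n =
      scoreCoeff a lam j 0 * empMoment x n 0 a + scoreCoeff a lam j 1 * empMoment x n 1 a := by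
  simp only [sampleMean, score_eq, empMoment, Finset.sum_add_distrib, ← Finset.mul_sum]
  ring

lemma sampleMean_score_mul_score (x : ℕ → ℝ) (n : ℕ) (a lam : ℝ) (j k : Fin 2) :
    sampleMean (fun i ↦ score a lam (x i) j * score a lam (x i) k) n =
      scoreCoeff a lam j 0 * scoreCoeff a lam k 0 * empMoment x n 0 (2 * a) +
      (scoreCoeff a lam j 0 * scoreCoeff a lam k 1 + scoreCoeff a lam j 1 * scoreCoeff a lam k 0) *
        empMoment x n 1 (2 * a) +
      scoreCoeff a lam j 1 * scoreCoeff a lam k 1 * empMoment x n 2 (2 * a) := by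
  simp only [sampleMean, score_mul_score, empMoment, Finset.sum_add_distrib, ← Finset.mul_sum]
  ring

lemma sampleCov_apply (z : ℕ → Fin 2 → ℝ) {n : ℕ} (hn : 1 ≤ n) (j k : Fin 2) :
    sampleCov z n j k = (n : ℝ) / (n - 1) * (sampleMean (fun i ↦ z i j * z i k) n -
      sampleMean (fun i ↦ z i j) n * sampleMean (fun i ↦ z i k) n) := by
  have hn' : (n : ℝ) ≠ 0 := by positivity
  simp only [sampleCov, Matrix.of_apply]
  set mj := sampleMean (fun i ↦ z i j) n with hmj
  set mk := sampleMean (fun i ↦ z i k) n with hmk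
  have ej : ∑ i ∈ Finset.range n, z i j = n * mj := by simp only [hmj, sampleMean]; field_simp
  have ek : ∑ i ∈ Finset.range n, z i k = n * mk := by simp only [hmk, sampleMean]; field_simp
  have e : ∑ i ∈ Finset.range n, (z i j - mj) * (z i k - mk) =
      ∑ i ∈ Finset.range n, z i j * z i k - n * mj * mk := by
    simp only [sub_mul, mul_sub, Finset.sum_sub_distrib, ← Finset.sum_mul, ← Finset.mul_sum, ej, ek]
    simp
    ring
  rw [e]
  simp only [sampleMean]
  field_simp

lemma tendsto_covEst {Ω : Type*} [MeasurableSpace Ω] {P : Measure Ω} [IsProbabilityMeasure P]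
    {X : Ω → ℝ} (hX : AEMeasurable X P) (h0 : ∀ᵐ ω ∂P, 0 ≤ X ω) {a lam : ℝ} (ha : 0 < a)
    {x : ℕ → ℝ} (hx : ∀ i, 0 ≤ x i) (hA : Tendsto (rateEst x) atTop (𝓝 a))
    (hl : Tendsto (lambdaEst x) atTop (𝓝 lam))
    (hm : ∀ r, Tendsto (fun n ↦ empMoment x n r a) atTop (𝓝 (censoredMoment X P r a)))
    (hm2 : ∀ r, Tendsto (fun n ↦ empMoment x n r (2 * a)) atTop
      (𝓝 (censoredMoment X P r (2 * a)))) :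
    Tendsto (covEst x) atTop (𝓝 (covMat (fun ω ↦ score a lam (X ω)) P)) := by
  refine tendsto_pi_nhds.2 fun j ↦ tendsto_pi_nhds.2 fun k ↦ ?_
  rw [covMat_score hX h0 ha]
  have h2a : 0 < 2 * a := by positivity
  have c := tendsto_scoreCoeff ha hA hl
  have e r := tendsto_empMoment_of_tendsto hx ha hA r (hm r)
  have e2 r := tendsto_empMoment_of_tendsto hx h2a (hA.const_mul 2) r (hm2 r)
  have hn : Tendsto (fun n : ℕ ↦ (n : ℝ) / (n - 1)) atTop (𝓝 1) := by
    simpa [sub_eq_add_neg] using tendsto_natCast_div_add_atTop (-1 : ℝ)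
  have := hn.mul ((((((c j 0).mul (c k 0)).mul (e2 0)).add
    ((((c j 0).mul (c k 1)).add ((c j 1).mul (c k 0))).mul (e2 1))).add
    (((c j 1).mul (c k 1)).mul (e2 2))).sub
    ((((c j 0).mul (e 0)).add ((c j 1).mul (e 1))).mul
      (((c k 0).mul (e 0)).add ((c k 1).mul (e 1)))))
  rw [one_mul] at this
  refine this.congr' ?_
  filter_upwards [eventually_ge_atTop 1] with n hn
  rw [covEst, sampleCov_apply _ hn, sampleMean_score_mul_score, sampleMean_score,
    sampleMean_score]

/-! ### Sampling from a positive stable law -/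

section Sampling

variable {Ω : Type*} [MeasurableSpace Ω] {P : Measure Ω} {X : Ω → ℝ}
  {Xs : ℕ → Ω → ℝ}

lemma aemeasurable_empMoment (hm : ∀ i, AEMeasurable (Xs i) P) (n r : ℕ) {A : Ω → ℝ}
    (hA : AEMeasurable A P) : AEMeasurable (fun ω ↦ empMoment (fun i ↦ Xs i ω) n r (A ω)) P := by
  unfold empMoment
  exact (Finset.aemeasurable_fun_sum _ fun i _ ↦ by have := hm i; fun_prop).const_mul _

/-- The random rate is measurable since it exceeds `t` exactly when the empirical transform at `t`
exceeds `exp (-1)`. -/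
lemma aemeasurable_rateEst (hm : ∀ i, AEMeasurable (Xs i) P) (hpos : ∀ᵐ ω ∂P, ∀ i, 0 < Xs i ω)
    (n : ℕ) : AEMeasurable (fun ω ↦ rateEst (fun i ↦ Xs i ω) n) P := by
  rcases Nat.eq_zero_or_pos n with rfl | hn
  · -- no equation is available for `n = 0`, where the rate is a constant junk value
    have : (fun ω ↦ rateEst (fun i ↦ Xs i ω) 0) = fun _ ↦ rateEst (fun _ ↦ 0) 0 := by
      ext ω
      simp only [rateEst]
      congr 1
    rw [this]
    exact aemeasurable_const
  · refine NullMeasurable.aemeasurable fun U hU ↦ ?_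
    refine measurable_of_Ioi (mδ := inferInstanceAs (MeasurableSpace (NullMeasurableSpace Ω P)))
      (f := fun ω ↦ rateEst (fun i ↦ Xs i ω) n) (fun t ↦ ?_) hU
    have hL := aemeasurable_empMoment hm n 0 (aemeasurable_const (b := t))
    simp only [empMoment_zero] at hL
    refine NullMeasurableSet.congr (hL.nullMeasurable (measurableSet_Ioi (a := Real.exp (-1)))) ?_
    filter_upwards [hpos] with ω hω
    exact propext (lt_rateEst_iff hω hn t).symm

variable [IsProbabilityMeasure P]

/-- Strong law of large numbers for the censored moments. -/
lemma ae_tendsto_empMoment (hX : AEMeasurable X P) (h0 : ∀ᵐ ω ∂P, 0 ≤ X ω)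
    (hindep : iIndepFun Xs P) (hident : ∀ i, IdentDistrib (Xs i) X P P) {s : ℝ} (hs : 0 < s)
    (r : ℕ) :
    ∀ᵐ ω ∂P, Tendsto (fun n ↦ empMoment (fun i ↦ Xs i ω) n r s) atTop
      (𝓝 (censoredMoment X P r s)) := by
  have hmeas : Measurable fun x : ℝ ↦ x ^ r * Real.exp (-(s * x)) := by fun_prop
  have hid i := (hident i).comp hmeas
  have key := strong_law_ae_real (fun i ω ↦ Xs i ω ^ r * Real.exp (-(s * Xs i ω)))
    ((hid 0).integrable_iff.2 (integrable_censored hX h0 hs r))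
    (fun i j hij ↦ (hindep.comp (fun _ x ↦ x ^ r * Real.exp (-(s * x))) fun _ ↦ hmeas).indepFun hij)
    (fun i ↦ (hid i).trans (hid 0).symm)
  filter_upwards [key] with ω hω
  have : P[fun ω ↦ Xs 0 ω ^ r * Real.exp (-(s * Xs 0 ω))] = censoredMoment X P r s :=
    (hid 0).integral_eq
  rw [this] at hω
  refine hω.congr fun n ↦ ?_
  simp only [empMoment]
  ring

/-- The central limit theorem for the vectors `score`. -/
lemma tendstoInDistribution_scoreFluct (hX : AEMeasurable X P) (h0 : ∀ᵐ ω ∂P, 0 ≤ X ω)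
    (hindep : iIndepFun Xs P) (hident : ∀ i, IdentDistrib (Xs i) X P P) {a γ lam : ℝ} (ha : 0 < a)
    (hm₀ : censoredMoment X P 0 a = Real.exp (-1))
    (hm₁ : Real.exp 1 * censoredMoment X P 1 a * a = γ) :
    TendstoInDistribution
      (fun (n : ℕ) ω ↦ √(n : ℝ) • scoreFluct (fun i ↦ Xs i ω) γ lam a n) atTop id (fun _ ↦ P)
      (multivariateGaussian 0 (covMat (fun ω ↦ score a lam (X ω)) P)) := by
  have he : Real.exp 1 * Real.exp (-1) = 1 := by rw [← Real.exp_add]; simp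
  let u : ℝ → EuclideanSpace ℝ (Fin 2) := fun x ↦ WithLp.toLp 2 (score a lam x)
  have hu : Measurable u := by
    refine (WithLp.measurable_toLp 2 _).comp (measurable_pi_lambda _ fun j ↦ ?_)
    simp only [score_eq]
    fun_prop
  have hcoord (j : Fin 2) : Measurable fun z : EuclideanSpace ℝ (Fin 2) ↦ z j := by fun_prop
  have hid i := (hident i).comp hu
  have hidj (j : Fin 2) : IdentDistrib (fun ω ↦ (u (Xs 0 ω)) j) (fun ω ↦ score a lam (X ω) j)
      P P := (hid 0).comp (hcoord j)
  have hmean : ∀ j, ∫ ω, (u (Xs 0 ω)) j ∂P =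
      (!₂[γ, -(lam * (γ * Real.log a + 1))] : EuclideanSpace ℝ (Fin 2)) j := by
    intro j
    rw [(hidj j).integral_eq, integral_score hX h0 ha, hm₀]
    fin_cases j
    · simp [scoreCoeff]
      linear_combination hm₁
    · simp [scoreCoeff]
      linear_combination -lam * he - lam * Real.log a * hm₁
  have hcov (j k : Fin 2) : covMat (fun ω ↦ score a lam (X ω)) P j k =
      cov[fun ω ↦ (u (Xs 0 ω)) j, fun ω ↦ (u (Xs 0 ω)) k; P] := by
    have e (Y : Ω → ℝ) (hY : AEMeasurable Y P) :
        cov[fun ω ↦ (u (Y ω)) j, fun ω ↦ (u (Y ω)) k; P] =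
          cov[fun z : EuclideanSpace ℝ (Fin 2) ↦ z j, fun z ↦ z k; P.map (u ∘ Y)] :=
      (covariance_map (hcoord j).aestronglyMeasurable (hcoord k).aestronglyMeasurable
        (hu.comp_aemeasurable hY)).symm
    rw [e _ (hident 0).aemeasurable_fst, (hid 0).map_eq, ← e _ hX]
    rfl
  have clt := tendstoInDistribution_multivariate (Z := fun i ω ↦ u (Xs i ω))
    (fun j ↦ (hidj j).memLp_iff.2 (memLp_score hX h0 ha lam j 2))
    (hindep.comp (fun _ ↦ u) fun _ ↦ hu) (fun i ↦ (hid i).trans (hid 0).symm) hmean hcov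
  refine clt.congr (fun n ↦ .of_forall fun ω ↦ ?_) .rfl
  ext j
  rcases Nat.eq_zero_or_pos n with rfl | hn
  · simp
  have hn0 : (n : ℝ) ≠ 0 := by positivity
  have hmul (z c : ℝ) : (√(n : ℝ))⁻¹ * (z - n * c) = √(n : ℝ) * (1 / (n : ℝ) * z - c) := by
    rw [← Real.sqrt_div_self]
    field_simp
  fin_cases j
  · simpa [scoreFluct, sampleMean, u] using hmul (∑ i ∈ Finset.range n, score a lam (Xs i ω) 0) γ
  · simpa [scoreFluct, sampleMean, u] using
      hmul (∑ i ∈ Finset.range n, score a lam (Xs i ω) 1) (-(lam * (γ * Real.log a + 1)))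

end Sampling

end PositiveStable

theorem proposition2 {Ω : Type*} [MeasurableSpace Ω] (P : Measure Ω) [IsProbabilityMeasure P]
    (γ lam : ℝ) (hγ₀ : 0 < γ) (hγ₁ : γ ≤ 1) (hlam : 0 < lam)
    (X : Ω → ℝ) (hX : HasPSLaw X γ lam P)
    (Xs : ℕ → Ω → ℝ) (hindep : iIndepFun Xs P) (hident : ∀ i, IdentDistrib (Xs i) X P P)
    (a : ℝ) (ha : a = invAt (laplace X P))
    (S : Ω → Fin 2 → ℝ) (hS : S = fun ω ↦ score a lam (X ω)) :
    -- the equations that define `a` and the statistic `A` have exactly one positive solution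
    (0 < a ∧ laplace X P a = Real.exp (-1) ∧
      ∀ b, 0 < b → laplace X P b = Real.exp (-1) → b = a) ∧
    (∀ᵐ ω ∂P, ∀ n : ℕ, 1 ≤ n →
      0 < rateEst (fun i ↦ Xs i ω) n ∧
      empLaplace (fun i ↦ Xs i ω) n (rateEst (fun i ↦ Xs i ω) n) = Real.exp (-1) ∧
      ∀ b, 0 < b → empLaplace (fun i ↦ Xs i ω) n b = Real.exp (-1) →
        b = rateEst (fun i ↦ Xs i ω) n) ∧
    -- strong consistency of the estimators
    (∀ᵐ ω ∂P, Tendsto (fun n ↦ gammaEst (fun i ↦ Xs i ω) n) atTop (𝓝 γ) ∧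
      Tendsto (fun n ↦ lambdaEst (fun i ↦ Xs i ω) n) atTop (𝓝 lam)) ∧
    -- asymptotic normality
    (∀ j, MemLp (fun ω ↦ S ω j) 2 P) ∧
    TendstoInDistribution
      (fun (n : ℕ) ω ↦ Real.sqrt n •
        (!₂[gammaEst (fun i ↦ Xs i ω) n - γ, lambdaEst (fun i ↦ Xs i ω) n - lam] :
          EuclideanSpace ℝ (Fin 2)))
      atTop id (fun _ ↦ P) (multivariateGaussian 0 (covMat S P)) ∧
    -- consistency of the plug-in covariance estimator
    (∀ᵐ ω ∂P, Tendsto (fun n ↦ covEst (fun i ↦ Xs i ω) n) atTop (𝓝 (covMat S P))) := by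
  subst hS
  have hXm := hX.aemeasurable
  have hX0 := hX.nonneg
  obtain ⟨ha0, hLa⟩ := hX.invAt_laplace_spec hγ₀ hlam
  rw [← ha] at ha0 hLa
  clear ha
  have h2a0 : 0 < 2 * a := by positivity
  have hlt s (hs : 0 < s) (hsa : s < a) : Real.exp (-1) < laplace X P s :=
    hLa ▸ hX.laplace_lt_laplace hγ₀ hlam hs.le hsa
  have hgt s (hs : a < s) : laplace X P s < Real.exp (-1) :=
    hLa ▸ hX.laplace_lt_laplace hγ₀ hlam ha0.le hs
  -- the moments at `a`, and `lam` as a function of `a`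
  have hla := hX.mul_rpow_eq_one ha0 hLa
  have hm₂ := hX.mul_censoredMoment_two ha0 hla
  have he : Real.exp 1 * Real.exp (-1) = 1 := by rw [← Real.exp_add]; simp
  have hm₁ : Real.exp 1 * censoredMoment X P 1 a * a = γ := by
    have := hX.mul_censoredMoment_one ha0
    rw [hla] at this
    linear_combination Real.exp 1 * this + γ * he
  have hlam' : a ^ (-γ) = lam := by
    rw [Real.rpow_neg ha0.le]
    exact (eq_inv_of_mul_eq_one_left hla).symm
  -- almost sure positivity and convergence of the empirical moments and of the random rate
  have hm i := (hident i).aemeasurable_fst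
  have hpos : ∀ᵐ ω ∂P, ∀ i, 0 < Xs i ω := ae_all_iff.2 fun i ↦
    (hident i).symm.ae_snd measurableSet_Ioi (hX.ae_pos hγ₀ hlam)
  have hslln {s : ℝ} (hs : 0 < s) : ∀ᵐ ω ∂P, ∀ r, Tendsto
      (fun n ↦ empMoment (fun i ↦ Xs i ω) n r s) atTop (𝓝 (censoredMoment X P r s)) :=
    ae_all_iff.2 fun r ↦ ae_tendsto_empMoment hXm hX0 hindep hident hs r
  have hrate : ∀ᵐ ω ∂P, Tendsto (rateEst fun i ↦ Xs i ω) atTop (𝓝 a) := by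
    have : ∀ᵐ ω ∂P, ∀ q : ℚ, 0 < q → Tendsto (fun n ↦ empLaplace (fun i ↦ Xs i ω) n q) atTop
        (𝓝 (laplace X P q)) := by
      refine ae_all_iff.2 fun q ↦ ?_
      by_cases hq : 0 < q
      · filter_upwards [hslln (s := (q : ℝ)) (by exact_mod_cast hq)] with ω hω _
        simpa only [empMoment_zero, censoredMoment_zero] using hω 0
      · exact .of_forall fun _ h ↦ absurd h hq
    filter_upwards [hpos, this] with ω hω h
    exact tendsto_rateEst hω ha0 hlt hgt h
  have hcons : ∀ᵐ ω ∂P, Tendsto (fun n ↦ gammaEst (fun i ↦ Xs i ω) n) atTop (𝓝 γ) ∧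
      Tendsto (fun n ↦ lambdaEst (fun i ↦ Xs i ω) n) atTop (𝓝 lam) := by
    filter_upwards [hpos, hrate, hslln ha0] with ω hω hA h
    have hg := tendsto_gammaEst hω ha0 hA (h 1)
    rw [hm₁] at hg
    exact ⟨hg, hlam' ▸ tendsto_lambdaEst ha0 hA hg⟩
  refine ⟨⟨ha0, hLa, fun b hb hLb ↦ ?_⟩, ?_, hcons,
    fun j ↦ memLp_score hXm hX0 ha0 lam j 2, ?_, ?_⟩
  · rcases lt_trichotomy b a with h | h | h
    · exact absurd hLb (hlt b hb h).ne'
    · exact h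
    · exact absurd hLb (hgt b h).ne
  · filter_upwards [hpos] with ω hω n hn
    exact ⟨rateEst_pos hω hn, empLaplace_rateEst hω hn, fun b _ hb ↦ eq_rateEst hω hn hb⟩
  · have clt := tendstoInDistribution_scoreFluct hXm hX0 hindep hident ha0 (lam := lam)
      ((censoredMoment_zero a).trans hLa) hm₁
    refine tendstoInDistribution_of_isEquivalent clt (fun n ↦ ?_) ?_
    · have hA := aemeasurable_rateEst hm hpos n
      have hg : AEMeasurable (fun ω ↦ gammaEst (fun i ↦ Xs i ω) n) P :=
        ((aemeasurable_empMoment hm n 1 hA).const_mul _).mul hA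
      have hl : AEMeasurable (fun ω ↦ lambdaEst (fun i ↦ Xs i ω) n) P := hA.pow hg.neg
      have hvec : AEMeasurable (fun ω ↦ ![gammaEst (fun i ↦ Xs i ω) n - γ,
          lambdaEst (fun i ↦ Xs i ω) n - lam]) P := by
        refine aemeasurable_pi_iff.2 fun j ↦ ?_
        fin_cases j
        · exact hg.sub_const γ
        · exact hl.sub_const lam
      exact ((WithLp.measurable_toLp 2 (Fin 2 → ℝ)).comp_aemeasurable hvec).fun_const_smul _
    · filter_upwards [hpos, hrate, hslln ha0] with ω hω hA h
      exact (Asymptotics.IsEquivalent.refl (u := fun n : ℕ ↦ √(n : ℝ))).smul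
        (estimators_isEquivalent hω ha0 hγ₀ hlam' hA hm₁ hm₂ (h 1) (h 2))
  · filter_upwards [hpos, hrate, hcons, hslln ha0, hslln h2a0] with ω hω hA hc h h2
    exact tendsto_covEst hXm hX0 ha0 (fun i ↦ (hω i).le) hA hc.2 h h2
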